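/- Let $n\ge 1$, $s\in(0,1)$, $p:=\max\{2,n/(2s)\}$, and let $\Omega\subset\mathbb R^n$ be open with non-empty exterior $\Omega_e:=\mathbb R^n\setminus\overline\Omega$ (for instance $\Omega$ bounded). *Operators.* Let $\mathcal C_{n,s}=\dfrac{4^s s\,\Gamma(n/2+s)}{\pi^{n/2}\,\Gamma(1-s)}$ and $\alpha(x,y)=\dfrac{\mathcal C_{n,s}^{1/2}}{\sqrt2}\dfrac{y-x}{|y-x|^{n/2+s+1}}$. For $u\in H^s=H^s(\mathbb R^n)$ and $A:\mathbb R^{2n}\to\mathbb C^n$ put $\nabla^s_Au(x,y)=(u(x)-u(y))\,\alpha(x,y)+A(x,y)\,u(x)$, and define $(-\Delta)^s_Au$ by $\langle(-\Delta)^s_Au,v\rangle=\langle\nabla^s_Au,\nabla^s_Av\rangle_{L^2(\mathbb R^{2n})}$ for $v\in H^s$. The fractional magnetic Schrödinger equation (FMSE) is $(-\Delta)^s_Au+qu=0$, with $q:\mathbb R^n\to\mathbb R$. *Potentials.* Write $A_s(x,y)=\frac12(A(x,y)+A(y,x))$, $A_a=A-A_s$, and for $x\ne y$ let $A_\parallel(x,y)=\frac{A(x,y)\cdot(x-y)}{|x-y|^2}(x-y)$.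 Let $\mathcal P_0$ be the set of pairs $(A,q)$ of measurable functions with 1. $x\mapsto\big(\int|A(y,x)|^2dy\big)^{1/2}$ and $x\mapsto\big(\int|A(x,y)|^2dy\big)^{1/2}$ in $L^{2p}(\mathbb R^n)$; 2. $A_{s\parallel}\in H^{sp-s}(\mathbb R^{2n},\mathbb C^n)$; 3. $A_{a\parallel}(x,y)\cdot(y-x)$ real and $\ge0$ for a.e. $(x,y)$; 4. $q\in L^p(\Omega)$. *Gauge.* Let $G$ be the set of strictly positive $\phi\in C^\infty(\mathbb R^n)$ with $\phi=1$ on $\Omega_e$. For $(A,q),(A',q')\in\mathcal P_0$ write $(A,q)\approx(A',q')$ through $\phi\in G$ if, for all $u\in H^s$, $$(-\Delta)^s_A(u\phi)+qu\phi=\phi\big((-\Delta)^s_{A'}u+q'u\big)$$ in the weak sense, i.e. tested against all $v\in H^s$, where $\langle\phi F,v\rangle=\langle F,\phi v\rangle$ and $\langle qu,v\rangle=\int_{\mathbb R^n}q\,u\,\overline v$. (Only those $u,v$ are used for which $u\phi,v\phi\in H^s$ and the integrals of $qu\phi\overline v$ and $q'u\phi\overline v$ converge; if $\Omega$ is bounded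 and $q,q'\in L^p(\mathbb R^n)$, these are all $u,v\in H^s$.) FMSE *has the gauge* $\approx$ if for each $(A,q)\in\mathcal P_0$ with $A\not\equiv0$ there are $\phi\in G$ with $\phi\not\equiv1$ and $(A',q')\in\mathcal P_0$ with $(A',q')\ne(A,q)$ and $(A,q)\approx(A',q')$ through $\phi$. **Lemma.** If $(A,q),(A',q')\in\mathcal P_0$ and $(A,q)\approx(A',q')$ through $\phi\in G$, then $\phi\equiv1$. Consequently FMSE does not have the gauge $\approx$. -/

import Mathlib

open MeasureTheory TemperedDistribution
open scoped ENNReal SchwartzMap ContDiff ComplexConjugate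

noncomputable section

namespace FMSE

/-- `ℝⁿ` with its Euclidean norm. -/
abbrev R (n : ℕ) : Type := EuclideanSpace ℝ (Fin n)

/-- `ℂⁿ` with its Hermitian norm. -/
abbrev C (n : ℕ) : Type := EuclideanSpace ℂ (Fin n)

/-- The inclusion `ℝⁿ ⊆ ℂⁿ`. -/
def cvec {n : ℕ} (w : R n) : C n := WithLp.toLp 2 (fun i => ((w i : ℝ) : ℂ))

/-- The bilinear product `a · w` of `a ∈ ℂⁿ` and `w ∈ ℝⁿ`. -/
def cdot {n : ℕ} (a : C n) (w : R n) : ℂ := ∑ i, a i * ((w i : ℝ) : ℂ)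

/-- `u ∈ Hʳ`, the `L²`-based Sobolev space, for a function `u` (only `r ≥ 0` is used, so that the
elements of `Hʳ` are `L²` functions). -/
def MemH {E F : Type*} [NormedAddCommGroup E] [InnerProductSpace ℝ E] [FiniteDimensional ℝ E]
    [MeasurableSpace E] [BorelSpace E] [NormedAddCommGroup F] [InnerProductSpace ℂ F]
    [CompleteSpace F] (r : ℝ) (u : E → F) : Prop :=
  ∃ h : MemLp u 2 (volume : Measure E),
    MemSobolev r 2 ((h.toLp u : Lp F 2 (volume : Measure E)) : 𝓢'(E, F))

/-! ### Operators on bivariate vector functions -/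

section Bivariate

variable {n : ℕ}

/-- The symmetric part `A_s`. -/
def symPart (A : R n → R n → C n) (x y : R n) : C n := (2⁻¹ : ℂ) • (A x y + A y x)

/-- The antisymmetric part `A_a = A - A_s`. -/
def antiPart (A : R n → R n → C n) (x y : R n) : C n := A x y - symPart A x y

open scoped Classical in
/-- The parallel part `A_∥`. -/
def parPart (A : R n → R n → C n) (x y : R n) : C n :=
  if x = y then A x y
  else (cdot (A x y) (x - y) / ((‖x - y‖ ^ 2 : ℝ) : ℂ)) • cvec (x - y)

/-- `𝒥₁ A (x) = (∫ |A(y,x)|² dy)^{1/2}`, with values in `[0,∞]`. -/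
def J1 (A : R n → R n → C n) (x : R n) : ℝ≥0∞ := (∫⁻ y, ‖A y x‖ₑ ^ 2) ^ (1 / 2 : ℝ)

/-- `𝒥₂ A (x) = (∫ |A(x,y)|² dy)^{1/2}`, with values in `[0,∞]`. -/
def J2 (A : R n → R n → C n) (x : R n) : ℝ≥0∞ := (∫⁻ y, ‖A x y‖ₑ ^ 2) ^ (1 / 2 : ℝ)

end Bivariate

/-! ### Fractional gradient and magnetic fractional Laplacian -/

/-- The constant `𝒞_{n,s}` for which the singular integral
`𝒞_{n,s} PV ∫ (u(x) - u(y)) / |x - y|^{n+2s} dy` has Fourier symbol `|ξ|^{2s}`. -/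
def fracConst (n : ℕ) (s : ℝ) : ℝ :=
  4 ^ s * s * Real.Gamma (n / 2 + s) / (Real.pi ^ (n / 2 : ℝ) * Real.Gamma (1 - s))

/-- `α(x,y) = (𝒞_{n,s}^{1/2} / √2) (y - x) / |y - x|^{n/2+s+1}`. -/
def alpha {n : ℕ} (s : ℝ) (x y : R n) : R n :=
  (√(fracConst n s) / √2 / ‖y - x‖ ^ (n / 2 + s + 1 : ℝ)) • (y - x)

/-- The fractional gradient `∇ˢu(x,y) = (u(x) - u(y)) α(x,y)`. -/
def fracGrad {n : ℕ} (s : ℝ) (u : R n → ℂ) (x y : R n) : C n :=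
  (u x - u y) • cvec (alpha s x y)

/-- The magnetic fractional gradient `∇ˢ_A u(x,y) = ∇ˢu(x,y) + A(x,y) u(x)`. -/
def magGrad {n : ℕ} (s : ℝ) (A : R n → R n → C n) (u : R n → ℂ) (x y : R n) : C n :=
  fracGrad s u x y + u x • A x y

/-- The magnetic fractional Laplacian `(-Δ)ˢ_A u`, acting on test functions `v ∈ Hˢ` by
`⟨(-Δ)ˢ_A u, v⟩ = ⟨∇ˢ_A u, ∇ˢ_A v⟩`, where the right-hand side is the inner product
`⟨f, g⟩ = ∫ f · conj g` of `L²(ℝ²ⁿ, ℂⁿ)`. (Mathlib's `inner ℂ` is antilinear in its first slot.) -/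
def magLaplacian {n : ℕ} (s : ℝ) (A : R n → R n → C n) (u : R n → ℂ) : (R n → ℂ) → ℂ :=
  fun v => ∫ z : R n × R n, inner ℂ (magGrad s A v z.1 z.2) (magGrad s A u z.1 z.2)

/-- Multiplication by the scalar potential: `⟨q u, v⟩ = ∫ q u conj v`. -/
def mulPot {n : ℕ} (q : R n → ℝ) (u : R n → ℂ) : (R n → ℂ) → ℂ :=
  fun v => ∫ x, (q x : ℂ) * u x * conj (v x)

/-- The operator of the fractional magnetic Schrödinger equation, `(-Δ)ˢ_A u + q u`. -/
def schrodinger {n : ℕ} (s : ℝ) (A : R n → R n → C n) (q : R n → ℝ) (u : R n → ℂ) :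
    (R n → ℂ) → ℂ :=
  fun v => magLaplacian s A u v + mulPot q u v

/-- The product `φ u` of a real function and a complex function. -/
def mulFun {n : ℕ} (φ : R n → ℝ) (u : R n → ℂ) : R n → ℂ := fun x => (φ x : ℂ) * u x

/-- The product `φ F` of a real function and a functional: `⟨φ F, v⟩ = ⟨F, φ v⟩`. -/
def mulDist {n : ℕ} (φ : R n → ℝ) (F : (R n → ℂ) → ℂ) : (R n → ℂ) → ℂ :=
  fun v => F (mulFun φ v)

/-! ### Potentials -/

/-- The exponent `p = max {2, n/(2s)}`. -/
def pExp (n : ℕ) (s : ℝ) : ℝ := max 2 (n / (2 * s))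

/-- The set `𝒫₀` of pairs of potentials `(A, q)`. -/
structure MemP0 {n : ℕ} (s : ℝ) (Ω : Set (R n)) (A : R n → R n → C n) (q : R n → ℝ) : Prop where
  meas : AEStronglyMeasurable (fun z : R n × R n => A z.1 z.2) volume
  /-- `𝒥₁ A ∈ L^{2p}(ℝⁿ)` -/
  memLp_J1 : MemLp (J1 A) (ENNReal.ofReal (2 * pExp n s)) volume
  /-- `𝒥₂ A ∈ L^{2p}(ℝⁿ)` -/
  memLp_J2 : MemLp (J2 A) (ENNReal.ofReal (2 * pExp n s)) volume
  /-- `A_{s∥} ∈ H^{sp-s}(ℝ²ⁿ, ℂⁿ)`; the type `WithLp 2 (ℝⁿ × ℝⁿ)` is Euclidean `ℝ²ⁿ`. -/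
  sobolev : MemH (s * pExp n s - s)
    (fun z : WithLp 2 (R n × R n) => parPart (symPart A) z.fst z.snd)
  /-- `A_{a∥}(x,y) · (y - x)` is real and nonnegative. -/
  nonneg : ∀ᵐ z : R n × R n, (cdot (parPart (antiPart A) z.1 z.2) (z.2 - z.1)).im = 0 ∧
    0 ≤ (cdot (parPart (antiPart A) z.1 z.2) (z.2 - z.1)).re
  /-- `q ∈ L^p(Ω)` -/
  memLp_q : MemLp q (ENNReal.ofReal (pExp n s)) (volume.restrict Ω)

/-! ### The gauge `≈` -/

/-- The exterior domain `Ω_e = ℝⁿ \ closure Ω`. -/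
def exterior {n : ℕ} (Ω : Set (R n)) : Set (R n) := (closure Ω)ᶜ

/-- The group `G` of smooth, strictly positive functions equal to `1` on `Ω_e`. -/
structure MemG {n : ℕ} (Ω : Set (R n)) (φ : R n → ℝ) : Prop where
  smooth : ContDiff ℝ ∞ φ
  pos : ∀ x, 0 < φ x
  eq_one : ∀ x ∈ exterior Ω, φ x = 1

/-- `(A,q) ≈ (A',q')` through `φ`: for all `u ∈ Hˢ`,
`(-Δ)ˢ_A (uφ) + q u φ = φ ((-Δ)ˢ_{A'} u + q' u)`, tested against all `v ∈ Hˢ`.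
The last four premises only say that the two sides are defined at `u, v`. They hold for all
`u, v ∈ Hˢ` as soon as `Ω` is bounded and `q, q' ∈ L^p(ℝⁿ)` (for instance if `q, q' ∈ L^p(Ω)` are
extended by zero); in any other case, having them as premises makes the relation weaker. -/
def ApproxVia {n : ℕ} (s : ℝ) (φ : R n → ℝ) (A : R n → R n → C n) (q : R n → ℝ)
    (A' : R n → R n → C n) (q' : R n → ℝ) : Prop :=
  ∀ u : R n → ℂ, MemH s u → ∀ v : R n → ℂ, MemH s v →
    MemH s (mulFun φ u) → MemH s (mulFun φ v) →
    Integrable (fun x => (q x : ℂ) * mulFun φ u x * conj (v x)) →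
    Integrable (fun x => (q' x : ℂ) * u x * conj (mulFun φ v x)) →
    schrodinger s A q (mulFun φ u) v = mulDist φ (schrodinger s A' q' u) v

/-- FMSE has the gauge `≈`: each pair `(A,q) ∈ 𝒫₀` with `A ≢ 0` is related to a different pair
`(A',q') ∈ 𝒫₀` through some `φ ∈ G` with `φ ≢ 1`. Functions are compared almost everywhere. -/
def HasApproxGauge {n : ℕ} (s : ℝ) (Ω : Set (R n)) : Prop :=
  ∀ (A : R n → R n → C n) (q : R n → ℝ), MemP0 s Ω A q →
    ¬ (∀ᵐ z : R n × R n, A z.1 z.2 = 0) →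
    ∃ (φ : R n → ℝ) (A' : R n → R n → C n) (q' : R n → ℝ),
      MemG Ω φ ∧ MemP0 s Ω A' q' ∧ (∃ x, φ x ≠ 1) ∧
      ¬ ((∀ᵐ z : R n × R n, A' z.1 z.2 = A z.1 z.2) ∧ ∀ᵐ x, q' x = q x) ∧
      ApproxVia s φ A q A' q'

end FMSE

end

noncomputable section

namespace FMSE

open Set

variable {n : ℕ}

/-! ### Algebra of vectors and parallel parts -/

/-! The relation is tested on real bumps `f`, `g` with disjoint supports. Then `q`, `q'` and the
terms quadratic in `A`, `A'` drop out, and the real part of the form is an integral against `k =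
|α|² + Re (A · α)`, or against its analogue `k'` for `A'` (`re_magLaplacian_of_disjoint`).
Subtracting the identities for `(f, g)` and `(g, f)` gives `∫ w (k + k') = 0` with the symmetric
weight `w(x,y) = (φ(x) - φ(y)) (f(x) g(y) - g(x) f(y))`. Symmetrizing `k` removes the symmetric part
of `A`, and the sign condition on the antisymmetric part leaves at least `2|α|²`
(`MemP0.re_crossKernel_add_swap`). If `φ(x₀) > φ(y₀)`, place `f` near `x₀` and `g` near `y₀`, on
opposite sides of a level of `φ`. Then `w ≥ 0`, so `w = 0` although `w(x₀,y₀) > 0`. Hence `φ` is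
constant (`ApproxVia.le`), and the exterior fixes the constant as `1`. One nonzero pair in `𝒫₀`
(`memP0_ballPot`) then refutes the gauge. -/

lemma inner_cvec_left (w : R n) (a : C n) : inner ℂ (cvec w) a = cdot a w := by
  simp [cvec, cdot, PiLp.inner_apply]

lemma inner_cvec_right (w : R n) (a : C n) : inner ℂ a (cvec w) = conj (cdot a w) := by
  rw [← inner_cvec_left, inner_conj_symm]

lemma cdot_smul_left (c : ℂ) (a : C n) (w : R n) : cdot (c • a) w = c * cdot a w := by
  simp [cdot, Finset.mul_sum, mul_assoc]

lemma cdot_sub_left (a b : C n) (w : R n) : cdot (a - b) w = cdot a w - cdot b w := by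
  simp [cdot, sub_mul]

lemma cdot_add_left (a b : C n) (w : R n) : cdot (a + b) w = cdot a w + cdot b w := by
  simp [cdot, add_mul, Finset.sum_add_distrib]

lemma cdot_smul_right (c : ℝ) (a : C n) (w : R n) : cdot a (c • w) = (c : ℂ) * cdot a w := by
  simp only [cdot, Finset.mul_sum, PiLp.smul_apply, smul_eq_mul, Complex.ofReal_mul]
  exact Finset.sum_congr rfl fun _ _ => by ring

lemma cdot_neg_right (a : C n) (w : R n) : cdot a (-w) = -cdot a w := by
  simp [cdot]

lemma cdot_cvec_self (w : R n) : cdot (cvec w) w = ((‖w‖ ^ 2 : ℝ) : ℂ) := by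
  rw [EuclideanSpace.norm_sq_eq]
  simp [cdot, cvec, pow_two]

lemma norm_cvec (w : R n) : ‖cvec w‖ = ‖w‖ := by
  simp [EuclideanSpace.norm_eq, cvec]

lemma continuous_cvec : Continuous (cvec : R n → C n) := by
  unfold cvec
  fun_prop

/-- Projecting onto the line of `x - y` keeps the component along it, so the sign condition of `𝒫₀`
can be read on `antiPart A` itself. -/
lemma cdot_parPart (A : R n → R n → C n) (x y : R n) :
    cdot (parPart A x y) (y - x) = cdot (A x y) (y - x) := by
  unfold parPart
  split_ifs with h
  · rfl
  · have h0 : ((‖x - y‖ ^ 2 : ℝ) : ℂ) ≠ 0 := by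
      rw [Complex.ofReal_ne_zero]
      exact pow_ne_zero 2 (norm_ne_zero_iff.2 (sub_ne_zero.2 h))
    rw [cdot_smul_left, ← neg_sub x y, cdot_neg_right, cdot_neg_right, cdot_cvec_self, mul_neg,
      div_mul_cancel₀ _ h0]

/-! ### The kernel `α` -/

lemma fracConst_pos {s : ℝ} (hs0 : 0 < s) (hs1 : s < 1) : 0 < fracConst n s := by
  unfold fracConst
  have h1 : 0 < Real.Gamma (n / 2 + s) := Real.Gamma_pos_of_pos (by positivity)
  have h2 : 0 < Real.Gamma (1 - s) := Real.Gamma_pos_of_pos (by linarith)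
  have := Real.pi_pos
  positivity

/-- The scalar factor of `α`. -/
def alphaCoeff (s : ℝ) (x y : R n) : ℝ :=
  √(fracConst n s) / √2 / ‖y - x‖ ^ (n / 2 + s + 1 : ℝ)

lemma alpha_eq (s : ℝ) (x y : R n) : alpha s x y = alphaCoeff s x y • (y - x) := rfl

lemma alphaCoeff_nonneg (s : ℝ) (x y : R n) : 0 ≤ alphaCoeff s x y := by
  unfold alphaCoeff
  positivity

lemma alphaCoeff_comm (s : ℝ) (x y : R n) : alphaCoeff s x y = alphaCoeff s y x := by
  unfold alphaCoeff
  rw [norm_sub_rev]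

lemma alpha_comm (s : ℝ) (x y : R n) : alpha s y x = -alpha s x y := by
  rw [alpha_eq, alpha_eq, alphaCoeff_comm, ← smul_neg, neg_sub]

lemma alpha_ne_zero {s : ℝ} (hs0 : 0 < s) (hs1 : s < 1) {x y : R n} (h : x ≠ y) :
    alpha s x y ≠ 0 := by
  have hyx : y - x ≠ 0 := sub_ne_zero.2 h.symm
  have h1 := fracConst_pos (n := n) hs0 hs1
  have h2 : 0 < ‖y - x‖ := norm_pos_iff.2 hyx
  rw [alpha_eq, alphaCoeff]
  exact smul_ne_zero (by positivity) hyx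

lemma continuousOn_alpha (s : ℝ) :
    ContinuousOn (fun z : R n × R n => alpha s z.1 z.2) {z | z.1 ≠ z.2} := by
  intro z hz
  have hz' : ‖z.2 - z.1‖ ≠ 0 := norm_ne_zero_iff.2 (sub_ne_zero.2 (Ne.symm hz))
  apply ContinuousAt.continuousWithinAt
  have hc : Continuous fun z : R n × R n => z.2 - z.1 := continuous_snd.sub continuous_fst
  have h1 : ContinuousAt (fun z : R n × R n => ‖z.2 - z.1‖ ^ (n / 2 + s + 1 : ℝ)) z :=
    ContinuousAt.rpow_const hc.norm.continuousAt (Or.inl hz')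
  have h2 : ContinuousAt (fun z : R n × R n => alphaCoeff s z.1 z.2) z :=
    ContinuousAt.div continuousAt_const h1
      (Real.rpow_pos_of_pos (lt_of_le_of_ne (norm_nonneg _) hz'.symm) _).ne'
  exact h2.smul hc.continuousAt

/-! ### The kernel of the magnetic form for functions with disjoint supports -/

/-- The kernel `|α|² + A · α`. -/
def crossKernel (s : ℝ) (A : R n → R n → C n) (z : R n × R n) : ℂ :=
  ((‖alpha s z.1 z.2‖ ^ 2 : ℝ) : ℂ) + cdot (A z.1 z.2) (alpha s z.1 z.2)

/-- Every term with both factors at the same point vanishes, in particular the one in `|A|²`; what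
survives is affine in `A`. -/
lemma inner_magGrad_of_mul_eq_zero (s : ℝ) (A : R n → R n → C n) {f g : R n → ℝ}
    (hfg : ∀ x, f x * g x = 0) (x y : R n) :
    inner ℂ (magGrad s A (fun x => (g x : ℂ)) x y) (magGrad s A (fun x => (f x : ℂ)) x y) =
      -(((f x * g y : ℝ) : ℂ) * crossKernel s A (x, y) +
        ((f y * g x : ℝ) : ℂ) * conj (crossKernel s A (x, y))) := by
  have hx : (f x : ℂ) * g x = 0 := mod_cast hfg x
  have hy : (f y : ℂ) * g y = 0 := mod_cast hfg y
  simp only [magGrad, fracGrad, crossKernel, inner_add_left, inner_add_right, inner_smul_left,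
    inner_smul_right, inner_cvec_left, cdot_cvec_self, map_sub, map_add, Complex.conj_ofReal,
    inner_cvec_right, Complex.ofReal_mul]
  linear_combination (((‖alpha s x y‖ ^ 2 : ℝ) : ℂ) + cdot (A x y) (alpha s x y) +
    conj (cdot (A x y) (alpha s x y)) + inner ℂ (A x y) (A x y)) * hx +
    ((‖alpha s x y‖ ^ 2 : ℝ) : ℂ) * hy

/-- The weight lives on a compact set off the diagonal, where `α` is continuous and `A` is
integrable. -/
lemma integrable_mul_crossKernel (s : ℝ) {A : R n → R n → C n}
    (hA : ∀ K : Set (R n × R n), IsCompact K → IntegrableOn (fun z => A z.1 z.2) K)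
    {f g : R n → ℝ} (hf : Continuous f) (hg : Continuous g) (hfc : HasCompactSupport f)
    (hgc : HasCompactSupport g) (hfg : Disjoint (tsupport f) (tsupport g)) :
    Integrable (fun z : R n × R n => ((f z.1 * g z.2 : ℝ) : ℂ) * crossKernel s A z) := by
  have hK : IsCompact (tsupport f ×ˢ tsupport g) := hfc.isCompact.prod hgc.isCompact
  have hsub : tsupport f ×ˢ tsupport g ⊆ {z : R n × R n | z.1 ≠ z.2} := fun z hz h =>
    hfg.le_bot ⟨hz.1, h ▸ hz.2⟩
  have hα := (continuousOn_alpha (n := n) s).mono hsub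
  rw [← integrableOn_iff_integrable_of_support_subset (s := tsupport f ×ˢ tsupport g)]
  · refine IntegrableOn.continuousOn_mul (by fun_prop) ?_ hK
    refine Integrable.add ?_ ?_
    · refine ContinuousOn.integrableOn_compact hK ?_
      exact Complex.continuous_ofReal.comp_continuousOn (hα.norm.pow 2)
    · refine integrable_finsetSum _ fun i _ => ?_
      refine IntegrableOn.mul_continuousOn ?_ ?_ hK
      · exact (EuclideanSpace.proj (𝕜 := ℂ) i).integrable_comp (hA _ hK)
      · exact Complex.continuous_ofReal.comp_continuousOn
          ((EuclideanSpace.proj (𝕜 := ℝ) i).continuous.comp_continuousOn hα)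
  · intro z hz
    by_contra hzK
    refine hz ?_
    have : f z.1 * g z.2 = 0 := by
      by_contra h0
      exact hzK ⟨subset_tsupport f (left_ne_zero_of_mul h0),
        subset_tsupport g (right_ne_zero_of_mul h0)⟩
    simp [this]

lemma integrable_mul_re_crossKernel (s : ℝ) {A : R n → R n → C n}
    (hA : ∀ K : Set (R n × R n), IsCompact K → IntegrableOn (fun z => A z.1 z.2) K)
    {f g : R n → ℝ} (hf : Continuous f) (hg : Continuous g) (hfc : HasCompactSupport f)
    (hgc : HasCompactSupport g) (hfg : Disjoint (tsupport f) (tsupport g)) :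
    Integrable (fun z : R n × R n => f z.1 * g z.2 * (crossKernel s A z).re) := by
  refine (integrable_mul_crossKernel s hA hf hg hfc hgc hfg).re.congr (.of_forall fun z => ?_)
  exact Complex.re_ofReal_mul _ _

lemma mul_eq_zero_of_disjoint_tsupport {f g : R n → ℝ}
    (hfg : Disjoint (tsupport f) (tsupport g)) (x : R n) : f x * g x = 0 := by
  by_contra h0
  exact hfg.le_bot ⟨subset_tsupport f (left_ne_zero_of_mul h0),
    subset_tsupport g (right_ne_zero_of_mul h0)⟩

/-- Taking real parts identifies the kernel with its conjugate, so both integrals involve the same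
real kernel. -/
lemma re_magLaplacian_of_disjoint (s : ℝ) {A : R n → R n → C n}
    (hA : ∀ K : Set (R n × R n), IsCompact K → IntegrableOn (fun z => A z.1 z.2) K)
    {f g : R n → ℝ} (hf : Continuous f) (hg : Continuous g) (hfc : HasCompactSupport f)
    (hgc : HasCompactSupport g) (hfg : Disjoint (tsupport f) (tsupport g)) :
    (magLaplacian s A (fun x => (f x : ℂ)) (fun x => (g x : ℂ))).re =
      -((∫ z : R n × R n, f z.1 * g z.2 * (crossKernel s A z).re) +
        ∫ z : R n × R n, g z.1 * f z.2 * (crossKernel s A z).re) := by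
  have h1 := integrable_mul_crossKernel s hA hf hg hfc hgc hfg
  have h2 := integrable_mul_crossKernel s hA hg hf hgc hfc hfg.symm
  have h2' : Integrable (fun z : R n × R n =>
      ((f z.2 * g z.1 : ℝ) : ℂ) * conj (crossKernel s A z)) := by
    refine (Complex.conjCLE.toContinuousLinearMap.integrable_comp h2).congr
      (.of_forall fun z => ?_)
    simp [mul_comm (g z.1 : ℂ)]
  unfold magLaplacian
  simp only [inner_magGrad_of_mul_eq_zero s A (mul_eq_zero_of_disjoint_tsupport hfg)]
  have h3 := integral_re (h1.add h2').neg
  simp only [RCLike.re_eq_complex_re, Pi.neg_apply, Pi.add_apply] at h3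
  rw [← h3, ← integral_add (integrable_mul_re_crossKernel s hA hf hg hfc hgc hfg)
    (integrable_mul_re_crossKernel s hA hg hf hgc hfc hfg.symm), ← integral_neg]
  refine integral_congr_ae (.of_forall fun z => ?_)
  simp only [Complex.neg_re, Complex.add_re, Complex.re_ofReal_mul, Complex.conj_re]
  ring

/-! ### Consequences of membership in `𝒫₀` -/

lemma two_le_pExp (n : ℕ) (s : ℝ) : 2 ≤ pExp n s := le_max_left _ _

/-- As `2p ≥ 2`, `𝒥₂ A` is locally in `L²`; by Tonelli `A` is square integrable on bounded squares,
and `t ≤ 1 + t²` gives integrability there. -/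
lemma MemP0.integrableOn {s : ℝ} {Ω : Set (R n)} {A : R n → R n → C n} {q : R n → ℝ}
    (h : MemP0 s Ω A q) (K : Set (R n × R n)) (hK : IsCompact K) :
    IntegrableOn (fun z => A z.1 z.2) K := by
  set B : Set (R n) := Prod.fst '' K ∪ Prod.snd '' K with hB
  have hBc : IsCompact B := (hK.image continuous_fst).union (hK.image continuous_snd)
  have hKB : K ⊆ B ×ˢ B := fun z hz =>
    ⟨Or.inl ⟨z, hz, rfl⟩, Or.inr ⟨z, hz, rfl⟩⟩
  refine IntegrableOn.mono_set ?_ hKB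
  refine ⟨h.meas.restrict, ?_⟩
  have : Fact (volume B < ⊤) := ⟨hBc.measure_lt_top⟩
  have hJ : MemLp (J2 A) 2 (volume.restrict B) := by
    refine (h.memLp_J2.restrict B).mono_exponent ?_
    rw [← ENNReal.ofReal_ofNat]
    exact ENNReal.ofReal_le_ofReal (by linarith [two_le_pExp n s])
  have hJ2 : ∫⁻ x in B, ∫⁻ y, ‖A x y‖ₑ ^ 2 < ⊤ := by
    have := hJ.2
    rw [eLpNorm_lt_top_iff_lintegral_rpow_enorm_lt_top (by simp) (by simp)] at this
    refine lt_of_eq_of_lt (lintegral_congr fun x => ?_) this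
    simp only [J2, enorm_eq_self, ENNReal.toReal_ofNat]
    rw [← ENNReal.rpow_mul]
    norm_num
  have hm : AEMeasurable (fun z : R n × R n => ‖A z.1 z.2‖ₑ ^ 2)
      ((volume.restrict B).prod (volume.restrict B)) := by
    rw [Measure.prod_restrict]
    exact (h.meas.restrict.enorm).pow_const 2
  have hle : ∀ t : ℝ≥0∞, t ≤ 1 + t ^ 2 := fun t => by
    rcases le_total t 1 with ht | ht
    · exact ht.trans le_self_add
    · exact (le_self_pow₀ ht two_ne_zero).trans le_add_self
  rw [HasFiniteIntegral]
  calc ∫⁻ z in B ×ˢ B, ‖A z.1 z.2‖ₑ ≤ ∫⁻ z in B ×ˢ B, (1 + ‖A z.1 z.2‖ₑ ^ 2) :=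
        lintegral_mono fun z => hle _
    _ = volume (B ×ˢ B) + ∫⁻ z in B ×ˢ B, ‖A z.1 z.2‖ₑ ^ 2 := by
        rw [lintegral_add_left measurable_const]
        simp
    _ < ⊤ := by
        refine ENNReal.add_lt_top.2 ⟨(hBc.prod hBc).measure_lt_top, ?_⟩
        rw [Measure.volume_eq_prod, ← Measure.prod_restrict, lintegral_prod _ hm]
        refine lt_of_le_of_lt (lintegral_mono fun x => ?_) hJ2
        exact setLIntegral_le_lintegral _ _

/-- Since `α(y,x) = -α(x,y)`, the sum equals `2|α|² + 2 Re (A_a · α)`, and `α` is a nonnegative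
multiple of `y - x`. -/
lemma MemP0.re_crossKernel_add_swap {s : ℝ} {Ω : Set (R n)} {A : R n → R n → C n}
    {q : R n → ℝ} (h : MemP0 s Ω A q) :
    ∀ᵐ z : R n × R n, 2 * ‖alpha s z.1 z.2‖ ^ 2 ≤
      (crossKernel s A z).re + (crossKernel s A z.swap).re := by
  filter_upwards [h.nonneg] with z hz
  have hz2 := hz.2
  rw [cdot_parPart] at hz2
  have key : (crossKernel s A z).re + (crossKernel s A z.swap).re =
      2 * ‖alpha s z.1 z.2‖ ^ 2 +
        2 * (alphaCoeff s z.1 z.2 * (cdot (antiPart A z.1 z.2) (z.2 - z.1)).re) := by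
    have e : cdot (A z.1 z.2) (z.2 - z.1) - cdot (A z.2 z.1) (z.2 - z.1) =
        ((2 : ℝ) : ℂ) * cdot (antiPart A z.1 z.2) (z.2 - z.1) := by
      simp only [antiPart, symPart, cdot_sub_left, cdot_smul_left, cdot_add_left]
      push_cast
      ring
    have e' := congrArg Complex.re e
    rw [Complex.sub_re, Complex.re_ofReal_mul] at e'
    simp only [crossKernel, Prod.fst_swap, Prod.snd_swap, Complex.add_re, Complex.ofReal_re,
      alpha_comm s z.1 z.2, norm_neg, cdot_neg_right, Complex.neg_re]
    rw [alpha_eq, cdot_smul_right, cdot_smul_right, Complex.re_ofReal_mul, Complex.re_ofReal_mul]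
    linear_combination alphaCoeff s z.1 z.2 * e'
  rw [key]
  have := mul_nonneg (alphaCoeff_nonneg s z.1 z.2) hz2
  linarith

/-! ### Test functions -/

lemma memH_ofReal {r : ℝ} {f : R n → ℝ} (hf : ContDiff ℝ ∞ f) (hfc : HasCompactSupport f) :
    MemH r (fun x => (f x : ℂ)) := by
  have h1 : ContDiff ℝ ∞ (fun x => (f x : ℂ)) := Complex.ofRealCLM.contDiff.comp hf
  have h2 : HasCompactSupport (fun x => (f x : ℂ)) := hfc.comp_left Complex.ofReal_zero
  refine ⟨(h2.toSchwartzMap h1).memLp 2 volume, ?_⟩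
  have := (h2.toSchwartzMap h1).memSobolev (s := r) (p := 2)
  rw [← Lp.toTemperedDistribution_toLp_eq (p := 2)] at this
  exact this

lemma mulFun_ofReal (φ f : R n → ℝ) :
    mulFun φ (fun x => (f x : ℂ)) = fun x => ((φ x * f x : ℝ) : ℂ) := by
  funext x
  simp [mulFun]

/-- The gauge relation, tested on a pair of bump functions with disjoint supports. -/
lemma ApproxVia.re_magLaplacian_eq {s : ℝ} {φ : R n → ℝ} {A A' : R n → R n → C n}
    {q q' : R n → ℝ} (h : ApproxVia s φ A q A' q') (hφ : ContDiff ℝ ∞ φ) {f g : R n → ℝ}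
    (hf : ContDiff ℝ ∞ f) (hg : ContDiff ℝ ∞ g) (hfc : HasCompactSupport f)
    (hgc : HasCompactSupport g) (hfg : ∀ x, f x * g x = 0) :
    (magLaplacian s A (fun x => ((φ x * f x : ℝ) : ℂ)) (fun x => (g x : ℂ))).re =
      (magLaplacian s A' (fun x => (f x : ℂ)) (fun x => ((φ x * g x : ℝ) : ℂ))).re := by
  have hfg' : ∀ x, (f x : ℂ) * g x = 0 := fun x => mod_cast hfg x
  have e1 : (fun x => (q x : ℂ) * ((φ x * f x : ℝ) : ℂ) * conj (g x : ℂ)) = fun _ => 0 := by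
    funext x
    rw [Complex.conj_ofReal, Complex.ofReal_mul]
    linear_combination (q x : ℂ) * φ x * hfg' x
  have e2 : (fun x => (q' x : ℂ) * (f x : ℂ) * conj ((φ x * g x : ℝ) : ℂ)) = fun _ => 0 := by
    funext x
    rw [Complex.conj_ofReal, Complex.ofReal_mul]
    linear_combination (q' x : ℂ) * φ x * hfg' x
  have H := h (fun x => (f x : ℂ)) (memH_ofReal hf hfc) (fun x => (g x : ℂ)) (memH_ofReal hg hgc)
  simp only [mulFun_ofReal, schrodinger, mulDist, mulPot, e1, e2, integral_zero, add_zero] at H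
  rw [H (memH_ofReal (hφ.mul hf) hfc.mul_left) (memH_ofReal (hφ.mul hg) hgc.mul_left)
    (integrable_zero _ _ _) (integrable_zero _ _ _)]

/-! ### Rigidity of the gauge -/

lemma ApproxVia.le {s : ℝ} (hs0 : 0 < s) (hs1 : s < 1) {Ω : Set (R n)}
    {A A' : R n → R n → C n} {q q' φ : R n → ℝ} (hP : MemP0 s Ω A q) (hP' : MemP0 s Ω A' q')
    (hφ : ContDiff ℝ ∞ φ) (h : ApproxVia s φ A q A' q') (x₀ y₀ : R n) : φ x₀ ≤ φ y₀ := by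
  by_contra! hlt
  -- The level `c` separates the supports: `f` lives in `{φ > c}` and `g` in `{φ < c}`.
  obtain ⟨c, hc1, hc2⟩ := exists_between hlt
  have hφc := hφ.continuous
  obtain ⟨f, hfU, hfc, hf, hf01, hfx⟩ := exists_contDiff_tsupport_subset (n := ⊤)
    ((isOpen_lt continuous_const hφc).mem_nhds hc2 : {x | c < φ x} ∈ nhds x₀)
  obtain ⟨g, hgV, hgc, hg, hg01, hgy⟩ := exists_contDiff_tsupport_subset (n := ⊤)
    ((isOpen_lt hφc continuous_const).mem_nhds hc1 : {x | φ x < c} ∈ nhds y₀)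
  have hf0 : ∀ x, 0 ≤ f x := fun x => (hf01 ⟨x, rfl⟩).1
  have hg0 : ∀ x, 0 ≤ g x := fun x => (hg01 ⟨x, rfl⟩).1
  have hdisj : Disjoint (tsupport f) (tsupport g) := by
    rw [Set.disjoint_left]
    intro x hx hx'
    have h1 : c < φ x := hfU hx
    have h2 : φ x < c := hgV hx'
    exact lt_asymm h1 h2
  have hdisj1 : Disjoint (tsupport (fun x => φ x * f x)) (tsupport g) :=
    hdisj.mono_left (tsupport_mul_subset_right (f := φ) (g := f))
  have hdisj2 : Disjoint (tsupport f) (tsupport (fun x => φ x * g x)) :=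
    hdisj.mono_right (tsupport_mul_subset_right (f := φ) (g := g))
  have hfg := mul_eq_zero_of_disjoint_tsupport hdisj
  have hfC := hf.continuous
  have hgC := hg.continuous
  have hφf : Continuous fun x => φ x * f x := hφc.mul hfC
  have hφg : Continuous fun x => φ x * g x := hφc.mul hgC
  have hφfc : HasCompactSupport fun x => φ x * f x := hfc.mul_left
  have hφgc : HasCompactSupport fun x => φ x * g x := hgc.mul_left
  set k : R n × R n → ℝ := fun z => (crossKernel s A z).re
  set k' : R n × R n → ℝ := fun z => (crossKernel s A' z).re
  set w : R n × R n → ℝ := fun z => (φ z.1 - φ z.2) * (f z.1 * g z.2 - g z.1 * f z.2) with hw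
  have hI := hP.integrableOn
  have hI' := hP'.integrableOn
  -- the tested identity and its integrated form
  have E1 := h.re_magLaplacian_eq hφ hf hg hfc hgc hfg
  have E2 := h.re_magLaplacian_eq hφ hg hf hgc hfc fun x => by rw [mul_comm, hfg]
  rw [re_magLaplacian_of_disjoint s hI hφf hgC hφfc hgc hdisj1,
    re_magLaplacian_of_disjoint s hI' hfC hφg hfc hφgc hdisj2] at E1
  rw [re_magLaplacian_of_disjoint s hI hφg hfC hφgc hfc hdisj2.symm,
    re_magLaplacian_of_disjoint s hI' hgC hφf hgc hφfc hdisj1.symm] at E2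
  have expand : ∀ B : R n → R n → C n,
      (∀ K : Set (R n × R n), IsCompact K → IntegrableOn (fun z => B z.1 z.2) K) →
      Integrable (fun z => w z * (crossKernel s B z).re) ∧
      ∫ z, w z * (crossKernel s B z).re =
        (∫ z : R n × R n, φ z.1 * f z.1 * g z.2 * (crossKernel s B z).re) +
        (∫ z : R n × R n, g z.1 * (φ z.2 * f z.2) * (crossKernel s B z).re) -
        (∫ z : R n × R n, φ z.1 * g z.1 * f z.2 * (crossKernel s B z).re) -
        ∫ z : R n × R n, f z.1 * (φ z.2 * g z.2) * (crossKernel s B z).re := by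
    intro B hB
    have i1 := integrable_mul_re_crossKernel s hB hφf hgC hφfc hgc hdisj1
    have i2 := integrable_mul_re_crossKernel s hB hgC hφf hgc hφfc hdisj1.symm
    have i3 := integrable_mul_re_crossKernel s hB hφg hfC hφgc hfc hdisj2.symm
    have i4 := integrable_mul_re_crossKernel s hB hfC hφg hfc hφgc hdisj2
    have e : (fun z => w z * (crossKernel s B z).re) = fun z : R n × R n =>
        φ z.1 * f z.1 * g z.2 * (crossKernel s B z).re +
        g z.1 * (φ z.2 * f z.2) * (crossKernel s B z).re -
        φ z.1 * g z.1 * f z.2 * (crossKernel s B z).re -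
        f z.1 * (φ z.2 * g z.2) * (crossKernel s B z).re := by
      funext z
      simp only [hw]
      ring
    rw [e]
    exact ⟨((i1.add i2).sub i3).sub i4, by
      rw [integral_sub (by simpa only [Pi.add_apply] using! (i1.add i2).sub i3) i4,
        integral_sub (by simpa only [Pi.add_apply] using! i1.add i2) i3, integral_add i1 i2]⟩
  obtain ⟨iw, ew⟩ := expand A hI
  obtain ⟨iw', ew'⟩ := expand A' hI'
  -- `E1 - E2` reads `∫ w k = -∫ w k'`: moving `φ` from one bump to the other reverses the sign.
  have hsum : ∫ z, (w z * k z + w z * k' z) = 0 := by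
    rw [integral_add iw iw', ew, ew']
    linarith
  -- symmetrization
  have hwswap : ∀ z, w z.swap = w z := fun z => by
    simp only [hw, Prod.fst_swap, Prod.snd_swap]
    ring
  have iS : Integrable fun z => w z * k z + w z * k' z := iw.add iw'
  have hsum' : ∫ z, ((w z * k z + w z * k' z) + (w z * k z.swap + w z * k' z.swap)) = 0 := by
    have hsw := integral_prod_swap (μ := (volume : Measure (R n))) (ν := (volume : Measure (R n)))
      (fun z => w z * k z + w z * k' z)
    have iSs := iS.swap
    simp only [Function.comp_def, hwswap, ← Measure.volume_eq_prod] at hsw iSs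
    rw [integral_add iS (by simpa only [Measure.volume_eq_prod] using iSs), hsw, hsum, add_zero]
  have iSs := iS.swap
  simp only [Function.comp_def, hwswap] at iSs
  -- Where `f(a) g(b) ≠ 0`, one has `φ(b) < c < φ(a)`; thus each of the two terms of `w` is
  -- nonnegative.
  have hw0 : ∀ z, 0 ≤ w z := by
    intro z
    have hneg : ∀ {a b : R n}, f a * g b ≠ 0 → φ b < φ a := fun hab =>
      lt_trans (hgV (subset_tsupport g (right_ne_zero_of_mul hab)))
        (hfU (subset_tsupport f (left_ne_zero_of_mul hab)))
    have t1 : 0 ≤ (φ z.1 - φ z.2) * (f z.1 * g z.2) := by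
      by_cases h0 : f z.1 * g z.2 = 0
      · simp [h0]
      · exact mul_nonneg (by linarith [hneg h0]) (mul_nonneg (hf0 _) (hg0 _))
    have t2 : 0 ≤ (φ z.2 - φ z.1) * (f z.2 * g z.1) := by
      by_cases h0 : f z.2 * g z.1 = 0
      · simp [h0]
      · exact mul_nonneg (by linarith [hneg h0]) (mul_nonneg (hf0 _) (hg0 _))
    simp only [hw]
    linarith
  have hwdiag : ∀ z : R n × R n, z.1 = z.2 → w z = 0 := fun z hz => by simp [hw, hz]
  -- The constant `4` adds the bound `2|α|²` for `A` and the one for `A'`.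
  have hlow : ∀ᵐ z : R n × R n, w z * (4 * ‖alpha s z.1 z.2‖ ^ 2) ≤
      (w z * k z + w z * k' z) + (w z * k z.swap + w z * k' z.swap) := by
    filter_upwards [hP.re_crossKernel_add_swap, hP'.re_crossKernel_add_swap] with z h1 h2
    have := mul_le_mul_of_nonneg_left (add_le_add h1 h2) (hw0 z)
    simp only [k, k']
    linarith
  have hnn : 0 ≤ᵐ[volume] fun z : R n × R n =>
      (w z * k z + w z * k' z) + (w z * k z.swap + w z * k' z.swap) := by
    filter_upwards [hlow] with z hz
    exact (mul_nonneg (hw0 z) (by positivity)).trans hz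
  have hae := (integral_eq_zero_iff_of_nonneg_ae hnn (iS.add iSs)).1 hsum'
  have hwae : w =ᵐ[volume] 0 := by
    filter_upwards [hae, hlow] with z hz hz'
    rw [hz] at hz'
    by_cases hd : z.1 = z.2
    · exact hwdiag z hd
    · have hpos : 0 < 4 * ‖alpha s z.1 z.2‖ ^ 2 := by
        have := norm_pos_iff.2 (alpha_ne_zero hs0 hs1 hd)
        positivity
      exact le_antisymm (nonpos_of_mul_nonpos_left hz' hpos) (hw0 z)
  have hwc : Continuous w := by fun_prop
  have hw_zero := (hwc.ae_eq_iff_eq volume continuous_zero).1 hwae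
  have := congrFun hw_zero (x₀, y₀)
  -- With `f(x₀) = g(y₀) = 1` and `g(x₀) = 0`, `w(x₀,y₀)` is exactly `φ(x₀) - φ(y₀) > 0`.
  have hgx : g x₀ = 0 := by simpa [hfx] using hfg x₀
  simp only [hw, hfx, hgy, hgx, Pi.zero_apply] at this
  linarith

lemma ApproxVia.eq_one {s : ℝ} (hs0 : 0 < s) (hs1 : s < 1) {Ω : Set (R n)}
    (hΩe : (exterior Ω).Nonempty) {A A' : R n → R n → C n} {q q' φ : R n → ℝ}
    (hP : MemP0 s Ω A q) (hP' : MemP0 s Ω A' q') (hφ : MemG Ω φ)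
    (h : ApproxVia s φ A q A' q') (x : R n) : φ x = 1 := by
  obtain ⟨y, hy⟩ := hΩe
  rw [← hφ.eq_one y hy]
  exact le_antisymm (h.le hs0 hs1 hP hP' hφ.smooth x y) (h.le hs0 hs1 hP hP' hφ.smooth y x)

/-! ### A nonzero antisymmetric potential in `𝒫₀` -/

/-- The potential `y - x`, restricted to pairs of points of the closed unit ball. -/
def ballPot (x y : R n) : C n :=
  (Metric.closedBall (0 : R n) 1 ×ˢ Metric.closedBall (0 : R n) 1).indicator
    (fun z => cvec (z.2 - z.1)) (x, y)

lemma ballPot_of_mem {x y : R n} (hx : x ∈ Metric.closedBall (0 : R n) 1)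
    (hy : y ∈ Metric.closedBall (0 : R n) 1) : ballPot x y = cvec (y - x) :=
  indicator_of_mem (mk_mem_prod hx hy) _

lemma ballPot_of_notMem {x y : R n}
    (h : ¬ (x ∈ Metric.closedBall (0 : R n) 1 ∧ y ∈ Metric.closedBall (0 : R n) 1)) :
    ballPot x y = 0 :=
  indicator_of_notMem (fun h' => h (mem_prod.1 h')) _

lemma ballPot_swap (x y : R n) : ballPot y x = -ballPot x y := by
  by_cases h : x ∈ Metric.closedBall (0 : R n) 1 ∧ y ∈ Metric.closedBall (0 : R n) 1
  · rw [ballPot_of_mem h.1 h.2, ballPot_of_mem h.2 h.1]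
    ext i
    simp [cvec]
  · rw [ballPot_of_notMem h, ballPot_of_notMem fun h' => h h'.symm, neg_zero]

lemma symPart_ballPot : symPart (ballPot (n := n)) = fun _ _ => 0 := by
  funext x y
  simp [symPart, ballPot_swap x y]

lemma antiPart_ballPot : antiPart (ballPot (n := n)) = ballPot := by
  funext x y
  simp [antiPart, symPart_ballPot]

lemma measurable_ballPot : Measurable fun z : R n × R n => ballPot z.1 z.2 :=
  Measurable.indicator (continuous_cvec.comp (by fun_prop)).measurable
    (Metric.isClosed_closedBall.measurableSet.prod Metric.isClosed_closedBall.measurableSet)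

lemma J1_ballPot : J1 (ballPot (n := n)) = J2 ballPot := by
  funext x
  simp only [J1, J2, ballPot_swap x, enorm_neg]

lemma J2_ballPot_le (x : R n) : J2 ballPot x ≤ (Metric.closedBall (0 : R n) 1).indicator
    (fun _ => (4 * volume (Metric.closedBall (0 : R n) 1)) ^ (1 / 2 : ℝ)) x := by
  by_cases hx : x ∈ Metric.closedBall (0 : R n) 1
  · rw [indicator_of_mem hx]
    unfold J2
    gcongr
    calc ∫⁻ y, ‖ballPot x y‖ₑ ^ 2
        ≤ ∫⁻ y, (Metric.closedBall (0 : R n) 1).indicator (fun _ => (4 : ℝ≥0∞)) y := by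
          refine lintegral_mono fun y => ?_
          by_cases hy : y ∈ Metric.closedBall (0 : R n) 1
          · rw [indicator_of_mem hy, ballPot_of_mem hx hy]
            -- The diameter `2` of the unit ball, squared, is the constant `4`.
            have h2 : ‖cvec (y - x)‖ₑ ≤ 2 := by
              rw [← ofReal_norm, norm_cvec]
              refine ENNReal.ofReal_le_of_le_toReal ((norm_sub_le _ _).trans ?_)
              rw [mem_closedBall_zero_iff] at hx hy
              rw [ENNReal.toReal_ofNat]
              linarith
            calc ‖cvec (y - x)‖ₑ ^ 2 ≤ 2 ^ 2 := by gcongr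
              _ = 4 := by norm_num
          · rw [ballPot_of_notMem fun h => hy h.2]
            simp
      _ = 4 * volume (Metric.closedBall (0 : R n) 1) := by
          rw [lintegral_indicator_const Metric.isClosed_closedBall.measurableSet]
  · have : ∀ y, ballPot x y = 0 := fun y => ballPot_of_notMem fun h => hx h.1
    simp [J2, this]

lemma memLp_J2_ballPot (p : ℝ≥0∞) : MemLp (J2 (ballPot (n := n))) p volume := by
  have hv : volume (Metric.closedBall (0 : R n) 1) ≠ ⊤ := measure_closedBall_lt_top.ne
  have hm : Measurable (J2 (ballPot (n := n))) := by
    have : Measurable fun z : R n × R n => ‖ballPot z.1 z.2‖ₑ ^ 2 :=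
      measurable_ballPot.enorm.pow_const 2
    exact this.lintegral_prod_right'.pow_const _
  have hc : (4 * volume (Metric.closedBall (0 : R n) 1)) ^ (1 / 2 : ℝ) ≠ ⊤ :=
    ENNReal.rpow_ne_top_of_nonneg (by norm_num) (ENNReal.mul_ne_top (by norm_num) hv)
  refine ⟨hm.aestronglyMeasurable, ?_⟩
  refine lt_of_le_of_lt (eLpNorm_mono_enorm (g := (Metric.closedBall (0 : R n) 1).indicator
    (fun _ => (4 * volume (Metric.closedBall (0 : R n) 1)) ^ (1 / 2 : ℝ))) fun x => ?_) ?_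
  · simpa using J2_ballPot_le x
  · refine lt_of_le_of_lt (eLpNorm_indicator_const_le _ p) ?_
    rw [enorm_eq_self]
    exact ENNReal.mul_lt_top hc.lt_top (ENNReal.rpow_lt_top_of_nonneg (by positivity) hv)

/-- Antisymmetry makes the Sobolev condition one on the zero function, and `A · (y - x)` is `|y -
x|²` or `0`; boundedness and compact support give the rest. -/
lemma memP0_ballPot (s : ℝ) (Ω : Set (R n)) : MemP0 s Ω ballPot (0 : R n → ℝ) where
  meas := measurable_ballPot.aestronglyMeasurable
  memLp_J1 := by
    rw [J1_ballPot]
    exact memLp_J2_ballPot _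
  memLp_J2 := memLp_J2_ballPot _
  sobolev := by
    have e : (fun z : WithLp 2 (R n × R n) => parPart (symPart ballPot) z.fst z.snd) = 0 := by
      funext z
      simp [symPart_ballPot, parPart, cdot]
    rw [e]
    refine ⟨MemLp.zero, ?_⟩
    rw [MemLp.toLp_zero, ← Lp.toTemperedDistributionCLM_apply, map_zero]
    exact memSobolev_fun_zero _ _ _ _
  nonneg := by
    refine .of_forall fun z => ?_
    rw [cdot_parPart, antiPart_ballPot]
    by_cases h : z.1 ∈ Metric.closedBall (0 : R n) 1 ∧ z.2 ∈ Metric.closedBall (0 : R n) 1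
    · rw [ballPot_of_mem h.1 h.2, cdot_cvec_self]
      exact ⟨Complex.ofReal_im _, by rw [Complex.ofReal_re]; positivity⟩
    · rw [ballPot_of_notMem h]
      simp [cdot]
  memLp_q := MemLp.zero

/-- A set of full measure is dense, hence meets the open set of off-diagonal pairs in the ball,
which is nonempty because `n ≥ 1`. -/
lemma ballPot_not_ae_zero (hn : 1 ≤ n) : ¬ ∀ᵐ z : R n × R n, ballPot z.1 z.2 = 0 := by
  intro h
  set U : Set (R n × R n) :=
    (Metric.ball (0 : R n) 1 ×ˢ Metric.ball (0 : R n) 1) ∩ {z | z.1 ≠ z.2} with hU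
  have hUo : IsOpen U := (Metric.isOpen_ball.prod Metric.isOpen_ball).inter
    (isOpen_ne_fun continuous_fst continuous_snd)
  have hUn : U.Nonempty := by
    refine ⟨(0, EuclideanSpace.single ⟨0, hn⟩ (1 / 2 : ℝ)), ⟨by simp, ?_⟩, ?_⟩
    · rw [mem_ball_zero_iff, PiLp.norm_single]
      norm_num
    · intro h0
      have := congrArg norm h0
      rw [PiLp.norm_single, norm_zero] at this
      norm_num at this
  obtain ⟨z, hzU, hz⟩ := (Measure.dense_of_ae h).inter_open_nonempty U hUo hUn
  have hz' : ballPot z.1 z.2 = 0 := hz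
  rw [ballPot_of_mem (Metric.ball_subset_closedBall hzU.1.1)
    (Metric.ball_subset_closedBall hzU.1.2), ← norm_eq_zero, norm_cvec, norm_eq_zero,
    sub_eq_zero] at hz'
  exact hzU.2 hz'.symm

end FMSE

end

theorem mainTheorem6 (n : ℕ) (hn : 1 ≤ n) (s : ℝ) (hs0 : 0 < s) (hs1 : s < 1)
    (Ω : Set (FMSE.R n)) (hΩ : IsOpen Ω) (hΩe : (FMSE.exterior Ω).Nonempty) :
    (∀ (A A' : FMSE.R n → FMSE.R n → FMSE.C n) (q q' : FMSE.R n → ℝ) (φ : FMSE.R n → ℝ),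
      FMSE.MemP0 s Ω A q → FMSE.MemP0 s Ω A' q' → FMSE.MemG Ω φ →
      FMSE.ApproxVia s φ A q A' q' → ∀ x, φ x = 1) ∧
    ¬ FMSE.HasApproxGauge s Ω := by
  refine ⟨fun A A' q q' φ hP hP' hφ h => h.eq_one hs0 hs1 hΩe hP hP' hφ, fun hG => ?_⟩
  obtain ⟨φ, A', q', hφ, hP', ⟨x, hx⟩, -, h⟩ :=
    hG FMSE.ballPot 0 (FMSE.memP0_ballPot s Ω) (FMSE.ballPot_not_ae_zero hn)
  exact hx (h.eq_one hs0 hs1 hΩe (FMSE.memP0_ballPot s Ω) hP' hφ x)
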